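/- Let $\alpha\in(0,1)$ be irrational, with continued fraction $\alpha=[0;a_1,a_2,\dots]$, and let $(q_n)_{n\ge 0}$ be its continuants: $q_{-1}=0$, $q_0=1$, $q_{n+1}=a_{n+1}q_n+q_{n-1}$. An infinite word over $\{0,1\}$ is Sturmian if for every $n\ge1$ it has exactly $n+1$ factors of length $n$; its slope is the limit of the frequency $|u|_1/|u|$ of the letter $1$ in its factors $u$ as $|u|\to\infty$. Let $c_\alpha$ be the characteristic Sturmian word of slope $\alpha$, that is, the limit $\lim_n L_n$, where $L_n$ is the unique factor of length $n$ of a Sturmian word $x$ of slope $\alpha$ such that both $0L_n$ and $1L_n$ are factors of $x$. Let $T$ be the shift, which deletes the first letter of an infinite word. Let $\rho=(\rho_n)_{n\ge 0}$ be a formal intercept of the slope $\alpha$, i.e. a sequence of integers with $0\le\rho_n<q_n$ and $\rho_{n+1}\equiv\rho_n \pmod{q_n}$ for all $n\ge 0$ (so $\rho_0=0$), and let $\rho=\sum_{i\ge 0}b_{i+1}q_i$ be its Ostrowski expansion, i.e. $\rho_n=\sum_{i=0}^{n-1}b_{i+1}q_i$ for all $n\geq 0$, where the integers $b_i\ge 0$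 satisfy $b_1\le a_1-1$, $b_i\le a_i$ for all $i\ge1$, and $b_i=0$ whenever $i\ge 1$ and $b_{i+1}=a_{i+1}$. For $n\ge 1$ let $$\lambda_n=q_{n+1}+q_n-\rho_{n+1}-2,$$ which is a nonnegative integer. Then: 1. For every $n\ge1$, the words $T^{\rho_n}(c_\alpha)$ and $T^{\rho_{n+1}}(c_\alpha)$ have the same prefix of length $\lambda_n$. 2. For every $n\ge 1$ with $b_{n+1}\ne 0$, $\lambda_n$ is the length of the longest common prefix of $T^{\rho_n}(c_\alpha)$ and $T^{\rho_{n+1}}(c_\alpha)$. 3. The sequence $(\lambda_n)_{n\ge1}$ is nondecreasing and unbounded. 4. Consequently the words $T^{\rho_n}(c_\alpha)$ converge (letterwise) to a unique infinite word $T^\rho(c_\alpha)=\lim_n T^{\rho_n}(c_\alpha)$, and for every $n\ge1$ it has the same prefix of length $q_n-1$ as $T^{\rho_n}(c_\alpha)$. -/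

import Mathlib

open Filter Topology

namespace FormalIntercept

/-- Infinite words over the alphabet `{0, 1}`; the first letter has index `0`. -/
abbrev Word : Type := ℕ → Fin 2

/-- The finite word of length `n` that occurs in `x` at position `i`. -/
def factorAt (x : Word) (i n : ℕ) : List (Fin 2) :=
  (List.range n).map fun j => x (i + j)

/-- The prefix of length `n` of `x`. -/
def prefixOf (x : Word) (n : ℕ) : List (Fin 2) := factorAt x 0 n

/-- The finite word `u` is a factor of `x`. -/
def IsFactor (x : Word) (u : List (Fin 2)) : Prop := ∃ i, factorAt x i u.length = u

/-- The shift map `T`, which removes the first letter. -/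
def shift (x : Word) : Word := fun n => x (n + 1)

/-- The complexity function `p(x, n)`: the number of factors of length `n`. -/
noncomputable def complexity (x : Word) (n : ℕ) : ℕ :=
  (Set.range fun i => factorAt x i n).ncard

/-- Sturmian words. -/
def IsSturmian (x : Word) : Prop := ∀ n, 1 ≤ n → complexity x n = n + 1

/-- `x` has slope `α`: the frequency `|u|₁ / |u|` of the letter `1` tends to `α` as the length of
the factor `u` of `x` tends to infinity. -/
def HasSlope (x : Word) (α : ℝ) : Prop :=
  ∀ ε : ℝ, 0 < ε → ∃ N : ℕ, ∀ u : List (Fin 2), IsFactor x u → N ≤ u.length →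
    |(u.count 1 : ℝ) / (u.length : ℝ) - α| < ε

/-- `u` is a left special factor of `x`. -/
def IsLeftSpecial (x : Word) (u : List (Fin 2)) : Prop :=
  IsFactor x (0 :: u) ∧ IsFactor x (1 :: u)

/-- `c` is the characteristic Sturmian word `c_α` of slope `α`: the limit of the left special
factors of a Sturmian word of slope `α`, i.e. the word all of whose prefixes are left special. -/
def IsCharacteristicWord (α : ℝ) (c : Word) : Prop :=
  ∃ x : Word, IsSturmian x ∧ HasSlope x α ∧ ∀ n, IsLeftSpecial x (prefixOf c n)

/-- The partial quotient `a_n` of the continued fraction `α = [a_0; a_1, a_2, …]`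
(with value `0` past the end of a terminating expansion). -/
noncomputable def partialQuotient (α : ℝ) (n : ℕ) : ℕ :=
  ((GenContFract.IntFractPair.stream α n).elim 0 fun p => p.b).toNat

/-- The continuants `q_n` of `α`: `q_{-1} = 0`, `q_0 = 1`, `q_{n+1} = a_{n+1} q_n + q_{n-1}`. -/
noncomputable def continuant (α : ℝ) : ℕ → ℕ
  | 0 => 1
  | 1 => partialQuotient α 1
  | n + 2 => partialQuotient α (n + 2) * continuant α (n + 1) + continuant α n

/-- `ρ = (ρ_n)` is a formal intercept of the slope `α`. (The entry `ρ_0` is forced to be `0`.) -/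
def IsFormalIntercept (α : ℝ) (ρ : ℕ → ℕ) : Prop :=
  ∀ n, ρ n < continuant α n ∧ ρ n ≡ ρ (n + 1) [MOD continuant α n]

/-- The Ostrowski conditions on a sequence `(b_i)_{i ≥ 1}`; the entry `b 0` is not used. -/
def OstrowskiConditions (α : ℝ) (b : ℕ → ℕ) : Prop :=
  b 1 + 1 ≤ partialQuotient α 1 ∧
  (∀ i, 1 ≤ i → b i ≤ partialQuotient α i) ∧
  (∀ i, 1 ≤ i → b (i + 1) = partialQuotient α (i + 1) → b i = 0)

/-- `ρ = ∑_{i ≥ 0} b_{i+1} q_i` is the Ostrowski expansion of `ρ`. -/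
def IsOstrowskiExpansion (α : ℝ) (ρ b : ℕ → ℕ) : Prop :=
  OstrowskiConditions α b ∧
  ∀ n, ρ n = ∑ i ∈ Finset.range n, b (i + 1) * continuant α i

/-- `λ_n = q_{n+1} + q_n - ρ_{n+1} - 2`. -/
noncomputable def lam (α : ℝ) (ρ : ℕ → ℕ) (n : ℕ) : ℕ :=
  continuant α (n + 1) + continuant α n - ρ (n + 1) - 2

end FormalIntercept

namespace FormalIntercept

/-! ### Factors and their numbers of ones -/

/-! The word `c` is mechanical: its letter at index `i` is `⌊(i+2)α⌋ - ⌊(i+1)α⌋`. This follows from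
balance: `0L` and `1L` are both factors, so every factor of length `n+1` has `C` or `C+1` ones,
where `C` is the number of ones in the prefix of length `n`, and the slope then forces `C =
⌊(n+1)α⌋` (`IsCharacteristicWord.ones_eq_floor`). Balance itself is derived from the complexity,
through a shortest unbalanced pair (`IsSturmian.balanced`).

Since `q_n α` is within `|q_n α - p_n|` of an integer, and no `mα` with `0 < m < q_{n+1}` is closer
than that to an integer, translation by `q_n` preserves the letters of `c` at the indices `i <
q_{n+1} - 2` and changes the one at `i = q_{n+1} - 2`. Now `ρ_{n+1} = ρ_n + b q_n`, so passing from
`T^{ρ_n} c` to `T^{ρ_{n+1}} c` makes `b` such translations; the last one first fails at the offset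
`t` with `ρ_n + t + (b-1) q_n = q_{n+1} - 2`, that is `t = λ_n`. The remaining claims follow from
`λ_{n+1} - λ_n = (a_{n+2} - b) q_{n+1}`, where `b` is now the digit from `ρ_{n+1}` to `ρ_{n+2}`, and
from `λ_n ≥ q_n - 1`. -/

lemma factorAt_eq_iff {x y : Word} {i j n : ℕ} :
    factorAt x i n = factorAt y j n ↔ ∀ t < n, x (i + t) = y (j + t) := by
  simp [factorAt, List.map_inj_left]

lemma length_factorAt (x : Word) (i n : ℕ) : (factorAt x i n).length = n := by
  simp [factorAt]

lemma isFactor_factorAt (x : Word) (i n : ℕ) : IsFactor x (factorAt x i n) :=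
  ⟨i, by rw [length_factorAt]⟩

/-- The number of ones in the factor of length `n` at position `i`. -/
def ones (x : Word) (i n : ℕ) : ℕ := (factorAt x i n).count 1

lemma ones_zero (x : Word) (i : ℕ) : ones x i 0 = 0 := by simp [ones, factorAt]

lemma ones_succ (x : Word) (i n : ℕ) : ones x i (n + 1) = ones x i n + (x (i + n) : ℕ) := by
  unfold ones factorAt
  rw [List.range_succ, List.map_append, List.count_append]
  congr 1
  have : ∀ a : Fin 2, List.count 1 [a] = (a : ℕ) := by decide
  exact this _

lemma ones_add (x : Word) (i m n : ℕ) :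
    ones x i (m + n) = ones x i m + ones x (i + m) n := by
  induction n with
  | zero => simp [ones_zero]
  | succ n ih => rw [← add_assoc, ones_succ, ih, ones_succ]; ring_nf

lemma ones_one (x : Word) (i : ℕ) : ones x i 1 = (x i : ℕ) := by
  simpa [ones_zero] using ones_succ x i 0

/-! ### Sturmian words are balanced -/

lemma finite_factors (x : Word) (n : ℕ) : (Set.range fun i => factorAt x i n).Finite :=
  (List.finite_length_eq (Fin 2) n).subset (by
    rintro _ ⟨i, rfl⟩
    exact length_factorAt x i n)

lemma complexity_zero (x : Word) : complexity x 0 = 1 := by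
  simp [complexity, factorAt]

lemma IsSturmian.complexity_eq {x : Word} (hx : IsSturmian x) (n : ℕ) :
    complexity x n = n + 1 := by
  rcases Nat.eq_zero_or_pos n with rfl | h
  · exact complexity_zero x
  · exact hx n h

/-- Subtracting `p` repeatedly moves any occurrence to a position below `K + p`. With `L = K + p`
this rules out eventual periodicity of a Sturmian word. -/
lemma complexity_le_of_eventually_periodic {x : Word} {K p : ℕ} (hp : 0 < p)
    (h : ∀ n, K ≤ n → x (n + p) = x n) (L : ℕ) : complexity x L ≤ K + p := by
  have key : ∀ i, ∃ i' < K + p, factorAt x i' L = factorAt x i L := by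
    intro i
    induction i using Nat.strong_induction_on with
    | _ i ih =>
      by_cases hi : i < K + p
      · exact ⟨i, hi, rfl⟩
      · obtain ⟨i', h1, h2⟩ := ih (i - p) (by omega)
        refine ⟨i', h1, h2.trans (factorAt_eq_iff.2 fun t _ => ?_)⟩
        rw [← h (i - p + t) (by omega)]
        congr 1
        omega
  classical
  calc complexity x L
      ≤ (((Finset.range (K + p)).image (fun i => factorAt x i L) : Finset (List (Fin 2))) :
          Set (List (Fin 2))).ncard := by
        refine Set.ncard_le_ncard ?_ (Finset.finite_toSet _)
        rintro _ ⟨i, rfl⟩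
        obtain ⟨i', h1, h2⟩ := key i
        simp only [Finset.coe_image, Finset.coe_range, Set.mem_image, Set.mem_Iio]
        exact ⟨i', h1, h2⟩
    _ ≤ K + p := by
        rw [Set.ncard_coe_finset]
        exact Finset.card_image_le.trans (by simp)

/-- A Sturmian word has at most one right special factor of each length. -/
lemma IsSturmian.rightSpecial_unique {x : Word} (hx : IsSturmian x) {m i i' j j' : ℕ}
    (hi : factorAt x i m = factorAt x i' m) (hi' : x (i + m) ≠ x (i' + m))
    (hj : factorAt x j m = factorAt x j' m) (hj' : x (j + m) ≠ x (j' + m)) :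
    factorAt x i m = factorAt x j m := by
  by_contra hne
  have pre : ∀ {k l}, factorAt x k (m + 1) = factorAt x l (m + 1) →
      factorAt x k m = factorAt x l m ∧ x (k + m) = x (l + m) := fun h =>
    ⟨factorAt_eq_iff.2 fun t ht => factorAt_eq_iff.1 h t (by omega),
      factorAt_eq_iff.1 h m (by omega)⟩
  set F := Set.range fun i => factorAt x i (m + 1)
  have hFfin : F.Finite := finite_factors x (m + 1)
  have hFc : F.ncard = m + 2 := hx.complexity_eq (m + 1)
  have hpair : ({factorAt x i (m + 1), factorAt x j (m + 1)} : Set _).ncard = 2 :=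
    Set.ncard_pair fun h => hne (pre h).1
  have hdiff : (F \ {factorAt x i (m + 1), factorAt x j (m + 1)}).ncard = m := by
    rw [Set.ncard_sdiff (by
      rintro _ (rfl | rfl)
      · exact ⟨i, rfl⟩
      · exact ⟨j, rfl⟩), hpair, hFc]
    omega
  have htake : ∀ k, (factorAt x k (m + 1)).take m = factorAt x k m := by
    intro k
    simp [factorAt, ← List.map_take, List.take_range]
  -- Deleting one extension of each of two distinct right special words leaves `m` words, which
  -- still truncate onto all `m + 1` factors of length `m`.
  have hsub : (Set.range fun i => factorAt x i m) ⊆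
      List.take m '' (F \ {factorAt x i (m + 1), factorAt x j (m + 1)}) := by
    rintro _ ⟨k, rfl⟩
    by_cases h1 : factorAt x k (m + 1) = factorAt x i (m + 1)
    · refine ⟨factorAt x i' (m + 1), ⟨⟨i', rfl⟩, ?_⟩, ?_⟩
      · rintro (h | h)
        · exact hi' (pre h).2.symm
        · exact hne (hi.trans (pre h).1)
      · exact (htake i').trans (hi.symm.trans (pre h1).1.symm)
    by_cases h2 : factorAt x k (m + 1) = factorAt x j (m + 1)
    · refine ⟨factorAt x j' (m + 1), ⟨⟨j', rfl⟩, ?_⟩, ?_⟩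
      · rintro (h | h)
        · exact hne (hj.trans (pre h).1).symm
        · exact hj' (pre h).2.symm
      · exact (htake j').trans (hj.symm.trans (pre h2).1.symm)
    · exact ⟨_, ⟨⟨k, rfl⟩, by rintro (h | h); exacts [h1 h, h2 h]⟩, htake k⟩
  have := (Set.ncard_le_ncard hsub (hFfin.sdiff.image _)).trans
    (Set.ncard_image_le hFfin.sdiff)
  rw [hdiff] at this
  have h2 := hx.complexity_eq m
  unfold complexity at h2
  omega

/-- A shortest unbalanced pair of factors has the form `0w0`, `1w1` with `w` a palindrome. -/
lemma exists_palindrome_of_minimal_unbalanced {x : Word} {N i j : ℕ}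
    (hmin : ∀ n < N, ∀ i j, ones x i n ≤ ones x j n + 1)
    (h : ones x i N + 2 ≤ ones x j N) :
    ∃ m, x i = 0 ∧ x j = 1 ∧ (∀ t < m, x (i + 1 + t) = x (j + 1 + t)) ∧
      x (i + 1 + m) = 0 ∧ x (j + 1 + m) = 1 ∧
      ∀ t < m, x (i + 1 + t) = x (i + 1 + (m - 1 - t)) := by
  -- The proper prefix and the complementary suffix each have excess at most 1 by minimality, while
  -- the total is at least 2; so both are exactly 1.
  have hmid : ∀ t, 0 < t → t < N → ones x j t = ones x i t + 1 ∧
      ones x j N = ones x i N + 2 := by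
    intro t ht htN
    obtain ⟨s, rfl⟩ := Nat.exists_eq_add_of_le htN.le
    have h1 := ones_add x i t s
    have h2 := ones_add x j t s
    have h3 := hmin t htN i j
    have h4 := hmin t htN j i
    have h5 := hmin s (by omega) (i + t) (j + t)
    have h6 := hmin s (by omega) (j + t) (i + t)
    omega
  have hlt : ∀ k, ((x k : Fin 2) : ℕ) < 2 := fun k => (x k).isLt
  have hN : 2 ≤ N := by
    by_contra hN
    interval_cases N
    · simp [ones_zero] at h
    · rw [ones_one, ones_one] at h
      have := hlt j
      omega
  obtain ⟨m, rfl⟩ := Nat.exists_eq_add_of_le' hN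
  have hval : ∀ {k l}, ((x k : Fin 2) : ℕ) = x l → x k = x l := fun h => Fin.ext h
  have e1 := (hmid 1 (by omega) (by omega)).1
  rw [ones_one, ones_one] at e1
  have eN := (hmid 1 (by omega) (by omega)).2
  have em := (hmid (m + 1) (by omega) (by omega)).1
  rw [ones_succ x j (m + 1), ones_succ x i (m + 1)] at eN
  have hi0 : (x i : ℕ) = 0 := by have := hlt j; omega
  have hj1 : (x j : ℕ) = 1 := by omega
  have hiL : (x (i + (m + 1)) : ℕ) = 0 := by have := hlt (j + (m + 1)); omega
  have hjL : (x (j + (m + 1)) : ℕ) = 1 := by omega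
  have hW : ∀ t ≤ m, ones x i (t + 1) = ones x (i + 1) t := by
    intro t _
    rw [add_comm t 1, ones_add, ones_one, hi0, zero_add]
  have hpal : ∀ t ≤ m, ones x (i + 1) t + ones x (i + 1) (m - t) = ones x (i + 1) m := by
    intro t ht
    have h1 := ones_add x (i + 1) (m - t) t
    rw [Nat.sub_add_cancel ht] at h1
    rcases Nat.eq_zero_or_pos t with rfl | ht0
    · simp [ones_zero]
    have hsufi := ones_add x i (m + 1 - t) (t + 1)
    have hsufj := ones_add x j (m + 1 - t) (t + 1)
    rw [show m + 1 - t + (t + 1) = m + 2 by omega] at hsufi hsufj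
    have hd := (hmid (m + 1 - t) (by omega) (by omega)).1
    have hT := (hmid (m + 1 - t) (by omega) (by omega)).2
    have ha := (hmid (t + 1) (by omega) (by omega)).1
    -- Comparing the end of `1w1` with the start of `0w0`, and the start of `1w1` with the end of
    -- `0w0`, shows that the prefix and the suffix of `w` of length `t` have equally many ones.
    have hb := hmin (t + 1) (by omega) (j + (m + 1 - t)) i
    have hc := hmin (t + 1) (by omega) j (i + (m + 1 - t))
    have hwt := hW t ht
    have hwd := hW (m - t) (by omega)
    rw [show m - t + 1 = m + 1 - t by omega] at hwd
    have hwm := hW m le_rfl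
    have hs : ones x i (m + 2) = ones x i (m + 1) + _ := ones_succ x i (m + 1)
    rw [hiL] at hs
    omega
  refine ⟨m, Fin.ext hi0, Fin.ext hj1, ?_, ?_, ?_, ?_⟩
  · intro t ht
    have h1 := (hmid (t + 1) (by omega) (by omega)).1
    have h2 := (hmid (t + 2) (by omega) (by omega)).1
    rw [ones_succ x j (t + 1), ones_succ x i (t + 1)] at h2
    apply hval
    rw [show i + 1 + t = i + (t + 1) by omega, show j + 1 + t = j + (t + 1) by omega]
    omega
  · rw [show i + 1 + m = i + (m + 1) by omega]; exact Fin.ext hiL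
  · rw [show j + 1 + m = j + (m + 1) by omega]; exact Fin.ext hjL
  · intro t ht
    have h1 := hpal t ht.le
    have h2 := hpal (t + 1) ht
    have h3 := ones_succ x (i + 1) t
    have h4 := ones_succ x (i + 1) (m - 1 - t)
    rw [show m - 1 - t + 1 = m - t by omega] at h4
    rw [show m - (t + 1) = m - 1 - t by omega] at h2
    apply hval
    omega

/-- In a Sturmian word, if `awa` and `bwb` are factors with `w` a palindrome and `a ≠ b`, then
`bw` is right special. -/
lemma IsSturmian.false_of_palindrome {x : Word} (hx : IsSturmian x) {m i j : ℕ}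
    (hij : x i ≠ x j) (hw : ∀ t < m, x (i + 1 + t) = x (j + 1 + t))
    (hi : x (i + 1 + m) = x i) (hj : x (j + 1 + m) = x j)
    (hpal : ∀ t < m, x (j + 1 + t) = x (j + 1 + (m - 1 - t)))
    (hns : ∀ k, (∀ t < m + 1, x (k + t) = x (j + t)) → x (k + 1 + m) = x j) : False := by
  have two : ∀ a b c : Fin 2, b ≠ c → a ≠ b → a = c := by decide
  -- Write `a = x i`, `b = x j`. No occurrence of `aw` starts inside `bwb`: it would place the final
  -- `b` opposite, in the palindrome `w`, to the `a` on which it starts.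
  have h1 : ∀ k ≤ m + 1, factorAt x (j + k) (m + 1) ≠ factorAt x i (m + 1) := by
    intro k hk h
    rw [factorAt_eq_iff] at h
    have h0 := h 0 (by omega)
    rcases Nat.eq_zero_or_pos k with rfl | hk0
    · exact hij h0.symm
    rcases hk.eq_or_lt with rfl | hkm
    · exact hij (h0.symm.trans (by rw [← hj]; congr 1; omega))
    · have h2 := h (m + 1 - k) (by omega)
      have h3 := hw (m - k) (by omega)
      have h4 := hpal (k - 1) (by omega)
      rw [show j + k + (m + 1 - k) = j + 1 + m by omega,
        show i + (m + 1 - k) = i + 1 + (m - k) by omega, hj, h3] at h2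
      rw [show j + 1 + (k - 1) = j + k + 0 by omega, h0,
        show m - 1 - (k - 1) = m - k by omega, ← h2] at h4
      exact hij h4
  -- A factor of length `m + 1` other than `aw` determines the next letter: otherwise its suffix of
  -- length `m` is right special, hence equals `w`, and the factor is `bw`, which is always followed
  -- by `b`.
  have h2 : ∀ k l, factorAt x k (m + 1) = factorAt x l (m + 1) →
      factorAt x k (m + 1) ≠ factorAt x i (m + 1) → x (k + 1 + m) = x (l + 1 + m) := by
    intro k l hkl hki
    by_contra hne
    have e : factorAt x (k + 1) m = factorAt x (i + 1) m := by
      refine hx.rightSpecial_unique (i' := l + 1) (j' := j + 1) ?_ hne (factorAt_eq_iff.2 hw)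
        (by rwa [hi, hj])
      rw [factorAt_eq_iff] at hkl ⊢
      intro t ht
      have := hkl (t + 1) (by omega)
      rwa [show k + (t + 1) = k + 1 + t by omega, show l + (t + 1) = l + 1 + t by omega] at this
    rw [factorAt_eq_iff] at e hkl
    have hki' : x k ≠ x i := by
      intro h
      refine hki (factorAt_eq_iff.2 fun t ht => ?_)
      rcases t with _ | t
      · exact h
      · rw [show k + (t + 1) = k + 1 + t by omega, show i + (t + 1) = i + 1 + t by omega]
        exact e t (by omega)
    have hkj : ∀ t < m + 1, x (k + t) = x (j + t) := by
      intro t ht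
      rcases t with _ | t
      · exact two _ _ _ hij hki'
      · rw [show k + (t + 1) = k + 1 + t by omega, show j + (t + 1) = j + 1 + t by omega,
          e t (by omega), hw t (by omega)]
    exact hne ((hns k hkj).trans (hns l fun t ht => (hkl t ht).symm.trans (hkj t ht)).symm)
  -- Pigeonhole: `m + 2` starting positions, but only `m + 1` factors other than `aw`. Since the
  -- next letter is determined, the repetition then propagates forever.
  obtain ⟨k, k', hkk, hk', hF⟩ : ∃ k k', k < k' ∧ k' ≤ m + 1 ∧
      factorAt x (j + k) (m + 1) = factorAt x (j + k') (m + 1) := by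
    set F := Set.range fun i => factorAt x i (m + 1)
    have hfin : F.Finite := finite_factors x (m + 1)
    have hcard : (F \ {factorAt x i (m + 1)}).ncard = m + 1 := by
      rw [Set.ncard_sdiff_singleton_of_mem (show factorAt x i (m + 1) ∈ F from ⟨i, rfl⟩)]
      have : F.ncard = m + 2 := hx.complexity_eq (m + 1)
      omega
    have hmaps : Set.MapsTo (fun k => factorAt x (j + k) (m + 1))
        ((Finset.range (m + 2) : Finset ℕ) : Set ℕ) (F \ {factorAt x i (m + 1)}) := by
      intro k hk
      simp only [Finset.coe_range, Set.mem_Iio] at hk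
      exact ⟨⟨j + k, rfl⟩, h1 k (by omega)⟩
    obtain ⟨a, ha, b, hb, hab, he⟩ := Set.exists_ne_map_eq_of_ncard_lt_of_maps_to
      (s := ((Finset.range (m + 2) : Finset ℕ) : Set ℕ)) (t := F \ {factorAt x i (m + 1)})
      (f := fun k => factorAt x (j + k) (m + 1))
      (by rw [hcard, Set.ncard_coe_finset]; simp)
      hmaps hfin.sdiff
    simp only [Finset.coe_range, Set.mem_Iio] at ha hb
    rcases lt_or_gt_of_ne hab with h | h
    · exact ⟨a, b, h, by omega, he⟩
    · exact ⟨b, a, h, by omega, he.symm⟩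
  have key : ∀ t, factorAt x (j + k + t) (m + 1) = factorAt x (j + k + t + (k' - k)) (m + 1) ∧
      factorAt x (j + k + t) (m + 1) ≠ factorAt x i (m + 1) := by
    intro t
    induction t using Nat.strong_induction_on with
    | _ t ih =>
      constructor
      · rcases t with _ | t
        · rw [add_zero, hF]; congr 1; omega
        · obtain ⟨ih1, ih2⟩ := ih t (by omega)
          have hn := h2 _ _ ih1 ih2
          rw [factorAt_eq_iff] at ih1 ⊢
          intro s hs
          rcases (Nat.lt_succ_iff.1 hs).eq_or_lt with rfl | hs
          · convert hn using 2 <;> omega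
          · convert ih1 (s + 1) (by omega) using 2 <;> omega
      · by_cases ht : t < k' - k
        · rw [add_assoc]; exact h1 _ (by omega)
        · obtain ⟨ih1, ih2⟩ := ih (t - (k' - k)) (by omega)
          rw [ih1] at ih2
          convert ih2 using 2
          omega
  have hper : ∀ n, j + k ≤ n → x (n + (k' - k)) = x n := by
    intro n hn
    have := factorAt_eq_iff.1 (key (n - (j + k))).1 0 (by omega)
    rw [show j + k + (n - (j + k)) = n by omega] at this
    exact this.symm
  have := complexity_le_of_eventually_periodic (by omega) hper (j + k + (k' - k))
  rw [hx.complexity_eq] at this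
  omega

/-- A shortest unbalanced pair is `0w0`, `1w1` with `w` a palindrome. By uniqueness `0w` and `1w`
are not both right special, and `false_of_palindrome` applies to one that is not. -/
theorem IsSturmian.balanced {x : Word} (hx : IsSturmian x) (n i j : ℕ) :
    ones x i n ≤ ones x j n + 1 := by
  classical
  by_contra hcon
  have hex : ∃ n, ∃ i j, ones x i n + 2 ≤ ones x j n := ⟨n, j, i, by omega⟩
  obtain ⟨i, j, h⟩ := Nat.find_spec hex
  obtain ⟨m, hi, hj, hw, hi', hj', hpal⟩ := exists_palindrome_of_minimal_unbalanced
    (fun n hn a b => by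
      have := Nat.find_min hex hn
      push Not at this
      have := this b a
      omega) h
  have hpal' : ∀ t < m, x (j + 1 + t) = x (j + 1 + (m - 1 - t)) := by
    intro t ht
    rw [← hw t ht, ← hw (m - 1 - t) (by omega), hpal t ht]
  have hne : x i ≠ x j := by rw [hi, hj]; decide
  by_cases hns : ∀ k, (∀ t < m + 1, x (k + t) = x (j + t)) → x (k + 1 + m) = x j
  · exact hx.false_of_palindrome hne hw (hi'.trans hi.symm) (hj'.trans hj.symm) hpal' hns
  refine hx.false_of_palindrome hne.symm (fun t ht => (hw t ht).symm) (hj'.trans hj.symm)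
    (hi'.trans hi.symm) hpal fun l hl => ?_
  by_contra hl'
  push Not at hns
  obtain ⟨k, hk, hk'⟩ := hns
  have := hx.rightSpecial_unique (m := m + 1) (i := k) (i' := j) (j := l) (j' := i)
    (factorAt_eq_iff.2 hk) (by rwa [show k + (m + 1) = k + 1 + m by omega,
      show j + (m + 1) = j + 1 + m by omega, hj', ← hj])
    (factorAt_eq_iff.2 hl) (by rwa [show l + (m + 1) = l + 1 + m by omega,
      show i + (m + 1) = i + 1 + m by omega, hi', ← hi])
  have h0 := factorAt_eq_iff.1 this 0 (by omega)
  exact hne ((hl 0 (by omega)).symm.trans (h0.symm.trans (hk 0 (by omega))))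

/-! ### The characteristic word as a mechanical word -/

/-- Cutting a long factor into blocks of length `L` puts its frequency of ones between `C / L` and
`(C + 1) / L`. -/
lemma HasSlope.le_and_le_of_bounds {x : Word} {α : ℝ} (h : HasSlope x α) {L C : ℕ} (hL : 0 < L)
    (hC : ∀ i, C ≤ ones x i L ∧ ones x i L ≤ C + 1) :
    (C : ℝ) ≤ α * L ∧ α * L ≤ C + 1 := by
  have hk : ∀ k i, k * C ≤ ones x i (k * L) ∧ ones x i (k * L) ≤ k * (C + 1) := by
    intro k
    induction k with
    | zero => simp [ones_zero]
    | succ k ih =>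
      intro i
      rw [Nat.succ_mul, Nat.succ_mul, Nat.succ_mul, ones_add]
      have h1 := ih i
      have h2 := hC (i + k * L)
      omega
  have hL' : (0 : ℝ) < L := by exact_mod_cast hL
  have aux : ∀ ε : ℝ, 0 < ε → (C : ℝ) / L < α + ε ∧ α - ε < (C + 1 : ℝ) / L := by
    intro ε hε
    obtain ⟨N, hN⟩ := h ε hε
    have hlen : N ≤ (N + 1) * L := by nlinarith
    have h1 := hN _ (isFactor_factorAt x 0 ((N + 1) * L)) (by rwa [length_factorAt])
    rw [length_factorAt] at h1
    obtain ⟨h2, h3⟩ := hk (N + 1) 0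
    have h2' : ((N + 1 : ℕ) : ℝ) * C ≤ ones x 0 ((N + 1) * L) := by exact_mod_cast h2
    have h3' : (ones x 0 ((N + 1) * L) : ℝ) ≤ ((N + 1 : ℕ) : ℝ) * (C + 1) := by exact_mod_cast h3
    have hN' : (0 : ℝ) < ((N + 1 : ℕ) : ℝ) := by positivity
    have hfold : ((factorAt x 0 ((N + 1) * L)).count 1 : ℝ) = ones x 0 ((N + 1) * L) := rfl
    rw [hfold, Nat.cast_mul, abs_lt] at h1
    have l1 : (C : ℝ) / L ≤ ones x 0 ((N + 1) * L) / (((N + 1 : ℕ) : ℝ) * L) := by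
      rw [div_le_div_iff₀ hL' (by positivity)]
      nlinarith
    have l2 : ones x 0 ((N + 1) * L) / (((N + 1 : ℕ) : ℝ) * L) ≤ (C + 1 : ℝ) / L := by
      rw [div_le_div_iff₀ (by positivity) hL']
      nlinarith
    constructor <;> linarith
  constructor
  · rw [← div_le_iff₀ hL']
    exact le_of_forall_pos_lt_add fun ε hε => (aux ε hε).1
  · rw [← le_div_iff₀ hL']
    exact le_of_forall_pos_lt_add fun ε hε => by linarith [(aux ε hε).2]

/-- The prefix of length `n` of `c_α` contains `⌊(n + 1) α⌋` ones. -/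
theorem IsCharacteristicWord.ones_eq_floor {α : ℝ} (hα : Irrational α) {c : Word}
    (hc : IsCharacteristicWord α c) (n : ℕ) :
    (ones c 0 n : ℤ) = ⌊((n : ℝ) + 1) * α⌋ := by
  obtain ⟨x, hx, hs, hl⟩ := hc
  obtain ⟨⟨i, hi⟩, ⟨j, hj⟩⟩ := hl n
  have hlen : ∀ a : Fin 2, (a :: prefixOf c n).length = n + 1 := by
    simp [prefixOf, length_factorAt]
  rw [hlen] at hi hj
  have hi' : ones x i (n + 1) = ones c 0 n := by
    unfold ones
    rw [hi]
    simp [prefixOf]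
  have hj' : ones x j (n + 1) = ones c 0 n + 1 := by
    unfold ones
    rw [hj]
    simp [prefixOf]
  -- The factors `0L` and `1L` have `C` and `C + 1` ones, so balance leaves only these two values at
  -- length `n + 1`.
  obtain ⟨h1, h2⟩ := hs.le_and_le_of_bounds (L := n + 1) (C := ones c 0 n) (by omega) fun k => by
    have h1 := hx.balanced (n + 1) k i
    have h2 := hx.balanced (n + 1) j k
    omega
  push_cast at h1 h2
  symm
  rw [Int.floor_eq_iff]
  push_cast
  refine ⟨by linarith, lt_of_le_of_ne (by linarith) fun h => ?_⟩
  have hirr : Irrational (((n + 1 : ℕ) : ℝ) * α) := hα.natCast_mul (by omega)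
  exact hirr.ne_nat (ones c 0 n + 1) (by push_cast; exact h)

lemma IsCharacteristicWord.apply_eq {α : ℝ} (hα : Irrational α) {c : Word}
    (hc : IsCharacteristicWord α c) (n : ℕ) :
    ((c n : ℕ) : ℤ) = ⌊((n : ℝ) + 2) * α⌋ - ⌊((n : ℝ) + 1) * α⌋ := by
  have h1 := hc.ones_eq_floor hα n
  have h2 := hc.ones_eq_floor hα (n + 1)
  rw [ones_succ, zero_add] at h2
  push_cast at h2
  rw [show (n : ℝ) + 1 + 1 = n + 2 by ring] at h2
  omega

/-! ### Continuants and best approximation -/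

/-- The complete remainders of `α`: the orbit of `α` under the Gauss map. -/
noncomputable def gaussOrbit (α : ℝ) : ℕ → ℝ
  | 0 => α
  | n + 1 => Int.fract (gaussOrbit α n)⁻¹

lemma irrational_gaussOrbit {α : ℝ} (hα : Irrational α) (n : ℕ) :
    Irrational (gaussOrbit α n) := by
  induction n with
  | zero => exact hα
  | succ n ih =>
    rw [gaussOrbit, Int.fract]
    exact ih.inv.sub_intCast _

lemma gaussOrbit_mem {α : ℝ} (hα : Irrational α) (h0 : 0 < α) (h1 : α < 1) (n : ℕ) :
    0 < gaussOrbit α n ∧ gaussOrbit α n < 1 := by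
  cases n with
  | zero => exact ⟨h0, h1⟩
  | succ n =>
    refine ⟨lt_of_le_of_ne (Int.fract_nonneg _) ?_, Int.fract_lt_one _⟩
    simpa using (irrational_gaussOrbit hα (n + 1)).ne_nat 0 |>.symm

/-- Irrationality keeps every remainder nonzero, so the stream never stops and the default value in
`partialQuotient` is never reached. -/
lemma exists_stream_eq {α : ℝ} (hα : Irrational α) (h0 : 0 < α) (h1 : α < 1) (n : ℕ) :
    ∃ p, GenContFract.IntFractPair.stream α n = some p ∧ p.fr = gaussOrbit α n := by
  induction n with
  | zero =>
    exact ⟨_, GenContFract.IntFractPair.stream_zero α,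
      Int.fract_eq_self.2 ⟨h0.le, h1⟩⟩
  | succ n ih =>
    obtain ⟨p, hp, hpf⟩ := ih
    exact ⟨_, GenContFract.IntFractPair.stream_succ_of_some hp
      (by rw [hpf]; exact (gaussOrbit_mem hα h0 h1 n).1.ne'), by rw [hpf]; rfl⟩

lemma partialQuotient_succ {α : ℝ} (hα : Irrational α) (h0 : 0 < α) (h1 : α < 1) (n : ℕ) :
    (partialQuotient α (n + 1) : ℤ) = ⌊(gaussOrbit α n)⁻¹⌋ := by
  obtain ⟨p, hp, hpf⟩ := exists_stream_eq hα h0 h1 n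
  have h := gaussOrbit_mem hα h0 h1 n
  have hs := GenContFract.IntFractPair.stream_succ_of_some hp (by rw [hpf]; exact h.1.ne')
  rw [partialQuotient, hs]
  simp only [Option.elim_some, GenContFract.IntFractPair.of, hpf]
  exact Int.toNat_of_nonneg (Int.floor_nonneg.2 (inv_nonneg.2 h.1.le))

lemma one_le_partialQuotient {α : ℝ} (hα : Irrational α) (h0 : 0 < α) (h1 : α < 1) (n : ℕ) :
    1 ≤ partialQuotient α (n + 1) := by
  have h := gaussOrbit_mem hα h0 h1 n
  have : (1 : ℤ) ≤ partialQuotient α (n + 1) := by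
    rw [partialQuotient_succ hα h0 h1, Int.le_floor]
    exact_mod_cast (one_le_inv₀ h.1).2 h.2.le
  exact_mod_cast this

lemma gaussOrbit_mul {α : ℝ} (hα : Irrational α) (h0 : 0 < α) (h1 : α < 1) (n : ℕ) :
    gaussOrbit α (n + 1) * gaussOrbit α n = 1 - partialQuotient α (n + 1) * gaussOrbit α n := by
  have h := (gaussOrbit_mem hα h0 h1 n).1.ne'
  have hq : (partialQuotient α (n + 1) : ℝ) = (⌊(gaussOrbit α n)⁻¹⌋ : ℝ) := by
    exact_mod_cast partialQuotient_succ hα h0 h1 n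
  rw [hq, gaussOrbit, Int.fract]
  field_simp

lemma continuant_succ_succ (α : ℝ) (n : ℕ) : continuant α (n + 2) =
    partialQuotient α (n + 2) * continuant α (n + 1) + continuant α n := by
  rw [continuant]

lemma continuant_pos_and_le {α : ℝ} (hα : Irrational α) (h0 : 0 < α) (h1 : α < 1) (n : ℕ) :
    0 < continuant α n ∧ continuant α n ≤ continuant α (n + 1) := by
  induction n with
  | zero => simpa [continuant] using one_le_partialQuotient hα h0 h1 0
  | succ n ih =>
    refine ⟨by omega, ?_⟩
    rw [continuant_succ_succ]
    have := one_le_partialQuotient hα h0 h1 (n + 1)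
    nlinarith

lemma continuant_lt {α : ℝ} (hα : Irrational α) (h0 : 0 < α) (h1 : α < 1) (n : ℕ) :
    continuant α (n + 1) < continuant α (n + 2) := by
  rw [continuant_succ_succ]
  have := one_le_partialQuotient hα h0 h1 (n + 1)
  have := continuant_pos_and_le hα h0 h1 n
  nlinarith

lemma le_continuant {α : ℝ} (hα : Irrational α) (h0 : 0 < α) (h1 : α < 1) (n : ℕ) :
    n ≤ continuant α n := by
  induction n with
  | zero => omega
  | succ n ih =>
    cases n with
    | zero => exact one_le_partialQuotient hα h0 h1 0
    | succ n => exact Nat.succ_le_of_lt (ih.trans_lt (continuant_lt hα h0 h1 n))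

/-- The numerators of the convergents of `α`. -/
noncomputable def numerator (α : ℝ) : ℕ → ℕ
  | 0 => 0
  | 1 => 1
  | n + 2 => partialQuotient α (n + 2) * numerator α (n + 1) + numerator α n

/-- The approximation errors `q_n α - p_n`. -/
noncomputable def approxError (α : ℝ) (n : ℕ) : ℝ := continuant α n * α - numerator α n

lemma approxError_zero (α : ℝ) : approxError α 0 = α := by
  simp [approxError, continuant, numerator]

lemma approxError_succ {α : ℝ} (hα : Irrational α) (h0 : 0 < α) (h1 : α < 1) (n : ℕ) :
    approxError α (n + 1) = -gaussOrbit α (n + 1) * approxError α n := by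
  induction n with
  | zero =>
    have h := gaussOrbit_mul hα h0 h1 0
    simp only [approxError, continuant, numerator]
    rw [show gaussOrbit α 0 = α from rfl] at h
    push_cast
    linarith
  | succ n ih =>
    have h := gaussOrbit_mul hα h0 h1 (n + 1)
    have hrec : approxError α (n + 2) =
        partialQuotient α (n + 2) * approxError α (n + 1) + approxError α n := by
      simp only [approxError, continuant, numerator]
      push_cast
      ring
    rw [hrec, ih]
    linear_combination -approxError α n * h

lemma numerator_det (α : ℝ) (n : ℕ) :
    (continuant α (n + 1) : ℤ) * numerator α n - continuant α n * numerator α (n + 1) =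
      (-1) ^ (n + 1) := by
  induction n with
  | zero => simp [continuant, numerator]
  | succ n ih =>
    rw [pow_succ, ← ih]
    simp only [continuant, numerator]
    push_cast
    ring

/-- Consecutive approximation errors have opposite signs and decreasing absolute values. -/
lemma approxError_sign {α : ℝ} (hα : Irrational α) (h0 : 0 < α) (h1 : α < 1) (n : ℕ) :
    (0 < approxError α n ∧ approxError α n < 1 ∧
      approxError α (n + 1) < 0 ∧ 0 < approxError α n + approxError α (n + 1)) ∨
    (approxError α n < 0 ∧ -1 < approxError α n ∧
      0 < approxError α (n + 1) ∧ approxError α n + approxError α (n + 1) < 0) := by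
  have step := approxError_succ hα h0 h1 n
  obtain ⟨t0, t1⟩ := gaussOrbit_mem hα h0 h1 (n + 1)
  have main : (0 < approxError α n ∧ approxError α n < 1) ∨
      (approxError α n < 0 ∧ -1 < approxError α n) := by
    clear step t0 t1
    induction n with
    | zero => left; rw [approxError_zero]; exact ⟨h0, h1⟩
    | succ n ih =>
      rw [approxError_succ hα h0 h1 n]
      obtain ⟨t0, t1⟩ := gaussOrbit_mem hα h0 h1 (n + 1)
      rcases ih with ⟨a, b⟩ | ⟨a, b⟩
      · right; constructor <;> nlinarith
      · left; constructor <;> nlinarith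
  rw [step]
  rcases main with ⟨a, b⟩ | ⟨a, b⟩
  · left; refine ⟨a, b, ?_, ?_⟩ <;> nlinarith
  · right; refine ⟨a, b, ?_, ?_⟩ <;> nlinarith

/-- Best approximation: `|m α - k| ≥ |q_n α - p_n|` for `0 < m < q_{n+1}`. -/
lemma abs_approxError_le {α : ℝ} (hα : Irrational α) (h0 : 0 < α) (h1 : α < 1) {n : ℕ}
    {m k : ℤ} (hm0 : 0 < m) (hm : m < continuant α (n + 1)) :
    |approxError α n| ≤ |m * α - k| := by
  have hdet := numerator_det α n
  set q : ℤ := ((continuant α n : ℕ) : ℤ) with hq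
  set q' : ℤ := ((continuant α (n + 1) : ℕ) : ℤ) with hq'
  set p : ℤ := ((numerator α n : ℕ) : ℤ) with hp
  set p' : ℤ := ((numerator α (n + 1) : ℕ) : ℤ) with hp'
  set s : ℤ := (-1) ^ (n + 1) with hs
  have hss : s * s = 1 := by rw [hs, ← pow_add]; exact Even.neg_one_pow ⟨n + 1, rfl⟩
  have hq0 : 0 < q := Int.natCast_pos.2 (continuant_pos_and_le hα h0 h1 n).1
  -- Cramer's rule: the two convergent vectors have determinant `±1`, so they form a basis of the
  -- integer lattice.
  obtain ⟨X, Y, hX, hY⟩ : ∃ X Y : ℤ, X * q + Y * q' = m ∧ X * p + Y * p' = k :=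
    ⟨s * (k * q' - m * p'), s * (m * p - k * q),
      by linear_combination s * m * hdet + m * hss, by linear_combination s * k * hdet + k * hss⟩
  have hlin : (m : ℝ) * α - k = X * approxError α n + Y * approxError α (n + 1) := by
    have e1 : approxError α n = q * α - p := by simp [approxError, hq, hp]
    have e2 : approxError α (n + 1) = q' * α - p' := by simp [approxError, hq', hp']
    rw [e1, e2, ← hX, ← hY]
    push_cast
    ring
  rw [hlin]
  -- The bounds `0 < m < q'` force `X ≠ 0` and exclude equal signs. As the two errors also have
  -- opposite signs, the two terms of the sum cannot cancel.
  have hcase : (1 ≤ X ∧ Y ≤ 0) ∨ (X ≤ -1 ∧ 0 ≤ Y) := by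
    rcases lt_trichotomy X 0 with h | h | h
    · right
      refine ⟨by omega, ?_⟩
      by_contra hY0
      nlinarith
    · exfalso
      subst h
      rcases le_or_gt Y 0 with h | h <;> nlinarith
    · left
      refine ⟨h, ?_⟩
      by_contra hY0
      nlinarith
  have sgn := approxError_sign hα h0 h1 n
  rcases hcase with ⟨a, b⟩ | ⟨a, b⟩
  · have a' : (1 : ℝ) ≤ X := by exact_mod_cast a
    have b' : (Y : ℝ) ≤ 0 := by exact_mod_cast b
    rcases sgn with ⟨u, -, v, -⟩ | ⟨u, -, v, -⟩
    · rw [abs_of_pos u]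
      exact le_trans (by nlinarith) (le_abs_self _)
    · rw [abs_of_neg u]
      exact le_trans (by nlinarith) (neg_le_abs _)
  · have a' : (X : ℝ) ≤ -1 := by exact_mod_cast a
    have b' : (0 : ℝ) ≤ Y := by exact_mod_cast b
    rcases sgn with ⟨u, -, v, -⟩ | ⟨u, -, v, -⟩
    · rw [abs_of_pos u]
      exact le_trans (by nlinarith) (neg_le_abs _)
    · rw [abs_of_neg u]
      exact le_trans (by nlinarith) (le_abs_self _)

lemma add_continuant_mul (α : ℝ) (m n : ℕ) :
    ((m : ℝ) + continuant α n) * α = m * α + approxError α n + (numerator α n : ℤ) := by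
  simp [approxError]; ring

/-- By best approximation, adding the error to `m α` cannot carry it past an integer; irrationality
excludes landing on the next one. -/
lemma floor_add_continuant {α : ℝ} (hα : Irrational α) (h0 : 0 < α) (h1 : α < 1) {m n : ℕ}
    (hm0 : 0 < m) (hm : m < continuant α (n + 1)) :
    ⌊((m : ℝ) + continuant α n) * α⌋ = ⌊(m : ℝ) * α⌋ + numerator α n := by
  have hirr : Irrational (((m + continuant α n : ℕ) : ℝ) * α) := hα.natCast_mul (by omega)
  have hbest : ∀ k : ℤ, |approxError α n| ≤ |(m : ℝ) * α - k| := fun k => by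
    simpa using abs_approxError_le hα h0 h1 (m := m) (k := k) (by exact_mod_cast hm0)
      (by exact_mod_cast hm)
  rw [add_continuant_mul, Int.floor_add_intCast]
  congr 1
  rw [Int.floor_eq_iff]
  have f1 := Int.floor_le ((m : ℝ) * α)
  have f2 := Int.lt_floor_add_one ((m : ℝ) * α)
  rcases approxError_sign hα h0 h1 n with ⟨u, -⟩ | ⟨u, -⟩
  · refine ⟨by linarith, ?_⟩
    have hb := hbest (⌊(m : ℝ) * α⌋ + 1)
    push_cast at hb
    rw [abs_of_pos u, abs_of_neg (by linarith)] at hb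
    refine lt_of_le_of_ne (by linarith) fun h => ?_
    refine hirr.ne_int (⌊(m : ℝ) * α⌋ + 1 + numerator α n) ?_
    push_cast
    rw [add_continuant_mul, h]
    push_cast
    ring
  · refine ⟨?_, by linarith⟩
    have hb := hbest ⌊(m : ℝ) * α⌋
    rw [abs_of_neg u, abs_of_nonneg (by linarith)] at hb
    linarith

/-- At `m = q_{n+1}` the error of `m` has the sign opposite to that of `q_n` and is smaller, so
adding the latter crosses an integer. -/
lemma floor_add_continuant_ne {α : ℝ} (hα : Irrational α) (h0 : 0 < α) (h1 : α < 1) (n : ℕ) :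
    ⌊((continuant α (n + 1) : ℝ) + continuant α n) * α⌋ ≠
      ⌊(continuant α (n + 1) : ℝ) * α⌋ + numerator α n := by
  rw [add_continuant_mul, Int.floor_add_intCast]
  have e : (continuant α (n + 1) : ℝ) * α
      = approxError α (n + 1) + (numerator α (n + 1) : ℤ) := by simp [approxError]
  rw [e, show approxError α (n + 1) + ((numerator α (n + 1) : ℤ) : ℝ) + approxError α n =
    (approxError α n + approxError α (n + 1)) + ((numerator α (n + 1) : ℤ) : ℝ) by ring,
    Int.floor_add_intCast, Int.floor_add_intCast]
  rcases approxError_sign hα h0 h1 n with ⟨a, b, c, d⟩ | ⟨a, b, c, d⟩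
  · have e1 : ⌊approxError α n + approxError α (n + 1)⌋ = 0 := by
      rw [Int.floor_eq_iff]; push_cast; constructor <;> linarith
    have e2 : ⌊approxError α (n + 1)⌋ < 0 := Int.floor_lt.2 (by exact_mod_cast c)
    omega
  · have e1 : ⌊approxError α n + approxError α (n + 1)⌋ < 0 :=
      Int.floor_lt.2 (by exact_mod_cast d)
    have e2 : 0 ≤ ⌊approxError α (n + 1)⌋ := Int.floor_nonneg.2 c.le
    omega

/-! ### The periods of the prefixes of the characteristic word -/

lemma IsCharacteristicWord.apply_add_continuant {α : ℝ} (hα : Irrational α) (h0 : 0 < α)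
    (h1 : α < 1) {c : Word} (hc : IsCharacteristicWord α c) {n i : ℕ}
    (hi : i + 2 < continuant α (n + 1)) : c (i + continuant α n) = c i := by
  have e1 := hc.apply_eq hα i
  have e2 := hc.apply_eq hα (i + continuant α n)
  have f1 := floor_add_continuant hα h0 h1 (m := i + 1) (n := n) (by omega) (by omega)
  have f2 := floor_add_continuant hα h0 h1 (m := i + 2) (n := n) (by omega) (by omega)
  push_cast at e2 f1 f2
  rw [add_right_comm (i : ℝ) _ 2, add_right_comm (i : ℝ) _ 1, f1, f2] at e2
  exact Fin.ext (by omega)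

lemma IsCharacteristicWord.apply_add_continuant_ne {α : ℝ} (hα : Irrational α) (h0 : 0 < α)
    (h1 : α < 1) {c : Word} (hc : IsCharacteristicWord α c) {n i : ℕ}
    (hi : i + 2 = continuant α (n + 1)) : c (i + continuant α n) ≠ c i := by
  have e1 := hc.apply_eq hα i
  have e2 := hc.apply_eq hα (i + continuant α n)
  have f1 := floor_add_continuant hα h0 h1 (m := i + 1) (n := n) (by omega) (by omega)
  have f2 := floor_add_continuant_ne hα h0 h1 n
  rw [← hi] at f2
  push_cast at e2 f1 f2
  rw [add_right_comm (i : ℝ) _ 2, add_right_comm (i : ℝ) _ 1, f1] at e2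
  intro h
  rw [h] at e2
  omega

/-- Only the starting points of the `b` translations must be below `q_{n+1} - 2`, hence the extra
`q_n` in the bound on the endpoint. -/
lemma IsCharacteristicWord.apply_add_mul_continuant {α : ℝ} (hα : Irrational α) (h0 : 0 < α)
    (h1 : α < 1) {c : Word} (hc : IsCharacteristicWord α c) {n i b : ℕ}
    (hi : i + b * continuant α n + 2 < continuant α (n + 1) + continuant α n) :
    c (i + b * continuant α n) = c i := by
  induction b with
  | zero => simp
  | succ b ih =>
    rw [add_mul, one_mul] at hi
    rw [← ih (by omega), add_mul, one_mul, ← add_assoc]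
    exact hc.apply_add_continuant hα h0 h1 (by omega)

/-! ### Shifts by a formal intercept -/

lemma shift_iterate (k : ℕ) (x : Word) (n : ℕ) : shift^[k] x n = x (k + n) := by
  induction k generalizing x with
  | zero => simp
  | succ k ih => rw [Function.iterate_succ_apply, ih, shift]; congr 1; omega

lemma prefixOf_eq_iff {x y : Word} {n : ℕ} : prefixOf x n = prefixOf y n ↔ ∀ t < n, x t = y t := by
  simp [prefixOf, factorAt_eq_iff]

lemma IsFormalIntercept.exists_digit {α : ℝ} {ρ : ℕ → ℕ} (hρ : IsFormalIntercept α ρ) (n : ℕ) :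
    ∃ b, ρ (n + 1) = ρ n + b * continuant α n := by
  obtain ⟨h1, h2⟩ := hρ n
  refine ⟨ρ (n + 1) / continuant α n, ?_⟩
  rw [Nat.ModEq, Nat.mod_eq_of_lt h1] at h2
  rw [h2, mul_comm, Nat.mod_add_div]

lemma lam_spec {α : ℝ} (hα : Irrational α) (h0 : 0 < α) (h1 : α < 1) {ρ : ℕ → ℕ}
    (hρ : IsFormalIntercept α ρ) (n : ℕ) :
    ρ (n + 1) + lam α ρ n + 2 = continuant α (n + 1) + continuant α n := by
  have h2 := (hρ (n + 1)).1
  have h3 := continuant_pos_and_le hα h0 h1 n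
  unfold lam
  omega

lemma continuant_le_lam {α : ℝ} (hα : Irrational α) (h0 : 0 < α) (h1 : α < 1) {ρ : ℕ → ℕ}
    (hρ : IsFormalIntercept α ρ) (n : ℕ) : continuant α n ≤ lam α ρ n + 1 := by
  have h2 := (hρ (n + 1)).1
  have h3 := lam_spec hα h0 h1 hρ n
  omega

lemma lam_le_lam_succ {α : ℝ} (hα : Irrational α) (h0 : 0 < α) (h1 : α < 1) {ρ : ℕ → ℕ}
    (hρ : IsFormalIntercept α ρ) (n : ℕ) : lam α ρ n ≤ lam α ρ (n + 1) := by
  have h2 := lam_spec hα h0 h1 hρ n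
  have h3 := lam_spec hα h0 h1 hρ (n + 1)
  obtain ⟨b, hb⟩ := hρ.exists_digit (n + 1)
  rw [show n + 1 + 1 = n + 2 from rfl] at h3 hb
  have h4 := (hρ (n + 2)).1
  have h5 := (continuant_pos_and_le hα h0 h1 n).2
  have h6 := continuant_succ_succ α n
  -- A larger digit would give `ρ_{n+2} ≥ (a_{n+2} + 1) q_{n+1} ≥ q_{n+2}`.
  have hba : b ≤ partialQuotient α (n + 2) := by
    by_contra h
    have : (partialQuotient α (n + 2) + 1) * continuant α (n + 1) ≤ b * continuant α (n + 1) :=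
      Nat.mul_le_mul_right _ (by omega)
    rw [add_mul, one_mul] at this
    omega
  have := Nat.mul_le_mul_right (continuant α (n + 1)) hba
  omega

lemma monotone_lam {α : ℝ} (hα : Irrational α) (h0 : 0 < α) (h1 : α < 1) {ρ : ℕ → ℕ}
    (hρ : IsFormalIntercept α ρ) : Monotone (lam α ρ) :=
  monotone_nat_of_le_succ (lam_le_lam_succ hα h0 h1 hρ)

lemma shift_apply_succ {α : ℝ} (hα : Irrational α) (h0 : 0 < α) (h1 : α < 1) {c : Word}
    (hc : IsCharacteristicWord α c) {ρ : ℕ → ℕ} (hρ : IsFormalIntercept α ρ) {n t : ℕ}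
    (ht : t < lam α ρ n) : shift^[ρ n] c t = shift^[ρ (n + 1)] c t := by
  obtain ⟨b, hb⟩ := hρ.exists_digit n
  have h2 := lam_spec hα h0 h1 hρ n
  rw [shift_iterate, shift_iterate, hb, add_right_comm,
    hc.apply_add_mul_continuant hα h0 h1 (by omega)]

lemma shift_apply_ne {α : ℝ} (hα : Irrational α) (h0 : 0 < α) (h1 : α < 1) {c : Word}
    (hc : IsCharacteristicWord α c) {ρ : ℕ → ℕ} (hρ : IsFormalIntercept α ρ) {n : ℕ} (hn : 1 ≤ n)
    (hne : ρ (n + 1) ≠ ρ n) :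
    shift^[ρ n] c (lam α ρ n) ≠ shift^[ρ (n + 1)] c (lam α ρ n) := by
  obtain ⟨b, hb⟩ := hρ.exists_digit n
  have h2 := lam_spec hα h0 h1 hρ n
  obtain ⟨m, rfl⟩ := Nat.exists_eq_add_of_le' hn
  have h3 := le_continuant hα h0 h1 (m + 2)
  rcases b with _ | b
  · simp at hb; exact absurd hb hne
  rw [add_mul, one_mul] at hb
  rw [shift_iterate, shift_iterate]
  have hq := (continuant_pos_and_le hα h0 h1 (m + 1)).1
  have e1 := hc.apply_add_mul_continuant hα h0 h1 (n := m + 1) (b := b)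
    (i := ρ (m + 1) + lam α ρ (m + 1)) (by omega)
  -- The digit is now `b + 1`: the first `b` translations preserve the letter, and the last starts
  -- exactly at index `q_{n+1} - 2`.
  have e2 := hc.apply_add_continuant_ne hα h0 h1 (n := m + 1)
    (i := ρ (m + 1) + lam α ρ (m + 1) + b * continuant α (m + 1)) (by omega)
  rw [e1] at e2
  rw [show ρ (m + 1 + 1) + lam α ρ (m + 1) = ρ (m + 1) + lam α ρ (m + 1) +
    b * continuant α (m + 1) + continuant α (m + 1) by omega]
  exact e2.symm

lemma shift_apply_of_le {α : ℝ} (hα : Irrational α) (h0 : 0 < α) (h1 : α < 1) {c : Word}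
    (hc : IsCharacteristicWord α c) {ρ : ℕ → ℕ} (hρ : IsFormalIntercept α ρ) {n m t : ℕ}
    (hnm : n ≤ m) (ht : t < lam α ρ n) : shift^[ρ m] c t = shift^[ρ n] c t := by
  induction m, hnm using Nat.le_induction with
  | base => rfl
  | succ m hm ih =>
    rw [← ih, shift_apply_succ hα h0 h1 hc hρ (ht.trans_le (monotone_lam hα h0 h1 hρ hm))]

lemma exists_tendsto_shift {α : ℝ} (hα : Irrational α) (h0 : 0 < α) (h1 : α < 1) {c : Word}
    (hc : IsCharacteristicWord α c) {ρ : ℕ → ℕ} (hρ : IsFormalIntercept α ρ) :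
    ∃ w : Word, Tendsto (fun n => shift^[ρ n] c) atTop (𝓝 w) := by
  -- The letter at `t` is stable from index `t + 2` on, since `λ_{t+2} ≥ q_{t+2} - 1 ≥ t + 1`.
  refine ⟨fun t => shift^[ρ (t + 2)] c t, tendsto_pi_nhds.2 fun t => ?_⟩
  refine tendsto_const_nhds.congr' ?_
  filter_upwards [eventually_ge_atTop (t + 2)] with m hm
  have h2 := continuant_le_lam hα h0 h1 hρ (t + 2)
  have h3 := le_continuant hα h0 h1 (t + 2)
  exact (shift_apply_of_le hα h0 h1 hc hρ hm (by omega)).symm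

lemma apply_eq_of_tendsto_shift {α : ℝ} (hα : Irrational α) (h0 : 0 < α) (h1 : α < 1) {c : Word}
    (hc : IsCharacteristicWord α c) {ρ : ℕ → ℕ} (hρ : IsFormalIntercept α ρ) {w : Word}
    (hw : Tendsto (fun n => shift^[ρ n] c) atTop (𝓝 w)) {n t : ℕ} (ht : t < lam α ρ n) :
    w t = shift^[ρ n] c t := by
  refine tendsto_nhds_unique (tendsto_pi_nhds.1 hw t) (tendsto_const_nhds.congr' ?_)
  filter_upwards [eventually_ge_atTop n] with m hm
  exact (shift_apply_of_le hα h0 h1 hc hρ hm ht).symm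

end FormalIntercept

theorem proposition10 (α : ℝ) (hα : Irrational α) (hα0 : 0 < α) (hα1 : α < 1)
    (c : FormalIntercept.Word) (hc : FormalIntercept.IsCharacteristicWord α c)
    (ρ : ℕ → ℕ) (hρ : FormalIntercept.IsFormalIntercept α ρ) :
    -- the subtractions in the definition of `λ_n` do not truncate
    (∀ n, 1 ≤ n → (FormalIntercept.lam α ρ n : ℤ) =
      (FormalIntercept.continuant α (n + 1) : ℤ) + (FormalIntercept.continuant α n : ℤ)
        - (ρ (n + 1) : ℤ) - 2) ∧
    -- (1) common prefix of length `λ_n`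
    (∀ n, 1 ≤ n →
      FormalIntercept.prefixOf (FormalIntercept.shift^[ρ n] c) (FormalIntercept.lam α ρ n) =
        FormalIntercept.prefixOf (FormalIntercept.shift^[ρ (n + 1)] c)
          (FormalIntercept.lam α ρ n)) ∧
    -- (2) it is the longest one if `b_{n+1} ≠ 0`
    (∀ b : ℕ → ℕ, FormalIntercept.IsOstrowskiExpansion α ρ b → ∀ n, 1 ≤ n → b (n + 1) ≠ 0 →
      IsGreatest {k : ℕ | FormalIntercept.prefixOf (FormalIntercept.shift^[ρ n] c) k =
          FormalIntercept.prefixOf (FormalIntercept.shift^[ρ (n + 1)] c) k}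
        (FormalIntercept.lam α ρ n)) ∧
    -- (3) `(λ_n)_{n ≥ 1}` is nondecreasing and unbounded
    MonotoneOn (FormalIntercept.lam α ρ) (Set.Ici 1) ∧
    ¬ BddAbove (FormalIntercept.lam α ρ '' Set.Ici 1) ∧
    -- the limit `T^ρ(c_α)` is well defined
    (∃! w : FormalIntercept.Word,
      Tendsto (fun n => FormalIntercept.shift^[ρ n] c) atTop (𝓝 w)) ∧
    (∀ w : FormalIntercept.Word,
      Tendsto (fun n => FormalIntercept.shift^[ρ n] c) atTop (𝓝 w) →
      ∀ n, 1 ≤ n →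
        FormalIntercept.prefixOf w (FormalIntercept.continuant α n - 1) =
          FormalIntercept.prefixOf (FormalIntercept.shift^[ρ n] c)
            (FormalIntercept.continuant α n - 1)) := by
  have hle := FormalIntercept.continuant_le_lam hα hα0 hα1 hρ
  refine ⟨fun n _ => ?_, fun n _ => ?_, fun b hb n hn hbn => ⟨?_, fun k hk => ?_⟩,
    (FormalIntercept.monotone_lam hα hα0 hα1 hρ).monotoneOn _, ?_, ?_, fun w hw n _ => ?_⟩
  · have := FormalIntercept.lam_spec hα hα0 hα1 hρ n
    omega
  · exact FormalIntercept.prefixOf_eq_iff.2 fun t ht =>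
      FormalIntercept.shift_apply_succ hα hα0 hα1 hc hρ ht
  · exact FormalIntercept.prefixOf_eq_iff.2 fun t ht =>
      FormalIntercept.shift_apply_succ hα hα0 hα1 hc hρ ht
  · by_contra hlt
    refine FormalIntercept.shift_apply_ne hα hα0 hα1 hc hρ hn ?_
      (FormalIntercept.prefixOf_eq_iff.1 hk _ (not_le.1 hlt))
    rw [hb.2 (n + 1), hb.2 n, Finset.sum_range_succ]
    have := Nat.mul_pos (Nat.pos_of_ne_zero hbn)
      (FormalIntercept.continuant_pos_and_le hα hα0 hα1 n).1
    omega
  · rintro ⟨B, hB⟩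
    have h1 := hB ⟨B + 2, by simp, rfl⟩
    have h2 := hle (B + 2)
    have h3 := FormalIntercept.le_continuant hα hα0 hα1 (B + 2)
    omega
  · obtain ⟨w, hw⟩ := FormalIntercept.exists_tendsto_shift hα hα0 hα1 hc hρ
    exact ⟨w, hw, fun w' hw' => tendsto_nhds_unique hw' hw⟩
  · refine FormalIntercept.prefixOf_eq_iff.2 fun t ht =>
      FormalIntercept.apply_eq_of_tendsto_shift hα hα0 hα1 hc hρ hw ?_
    have := hle n
    omega
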